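/- Let $d_1,d_2$ be integers with $|d_1|\ge 2$ and $|d_2|\ge 2$, and let $\zeta,c\in\mathbb{C}$ be roots of unity. Consider the rational maps $f(z)=z^{d_1}$ and $g(z)=\zeta z^{d_2}$ as self-maps of $\mathbb{P}^1(\mathbb{C})=\mathbb{C}\cup\{\infty\}$ (they need not be polynomials), write $f^{\circ m}$ and $g^{\circ n}$ for their iterates ($f^{\circ 0}=g^{\circ 0}=\mathrm{id}$), and define \[ \hat S^2_{f,g,c}=\{(m,n)\in\mathbb{Z}_{\ge 0}^2 : \exists\,\lambda\in\mathbb{P}^1(\mathbb{C}),\ f^{\circ m}(\lambda)=g^{\circ n}(\lambda)=c\}. \] Then \[ \hat S^2_{f,g,c}=\{(m,n)\in\mathbb{Z}_{\ge 0}^2 : \exists\,\lambda\in\mathbb{C}^\times,\ f^{\circ m}(\lambda)=g^{\circ n}(\lambda)=c\}, \] and this set is semi-linear. Here a subset of $\mathbb{Z}_{\ge 0}^2$ is called linear if it is of the form $a+M$ with $a\in\mathbb{Z}_{\ge 0}^2$ and $M$ a finitely generated submonoid of $(\mathbb{Z}_{\ge 0}^2,+,0)$, and semi-linear if it is a finite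 (possibly empty) union of linear sets. -/

import Mathlib

open Polynomial
open scoped OnePoint

/-- The self-map of the Riemann sphere `ℙ¹(ℂ) = ℂ ∪ {∞}` given by a rational function
`F = P / Q` in lowest terms with `Q` monic. A finite point `z` goes to `P(z) / Q(z)`, or to `∞` if
it is a pole. The point `∞` goes to the limit of `P(z) / Q(z)` as `z → ∞`, which is `∞` if
`deg P > deg Q` and otherwise the coefficient of `z ^ (deg Q)` in `P`. -/
noncomputable def ratMap (F : RatFunc ℂ) : OnePoint ℂ → OnePoint ℂ
  | none =>
      if F.denom.natDegree < F.num.natDegree then ∞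
      else ((F.num.coeff F.denom.natDegree : ℂ) : OnePoint ℂ)
  | some z =>
      if F.denom.eval z = 0 then ∞
      else ((F.num.eval z / F.denom.eval z : ℂ) : OnePoint ℂ)

/-- The rank-two recurrence set of `(f, g, c)`: all `(m, n)` such that
`f^{∘m}(λ) = g^{∘n}(λ) = c(λ)` for some `λ ∈ ℙ¹(ℂ)`. -/
def rankTwoRecurrenceSet (f g c : RatFunc ℂ) : Set (ℕ × ℕ) :=
  {p | ∃ z : OnePoint ℂ,
    (ratMap f)^[p.1] z = (ratMap g)^[p.2] z ∧ (ratMap g)^[p.2] z = ratMap c z}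

/-!
A monomial map `w ↦ a * w ^ d` with `a, d ≠ 0` preserves `{0, ∞}`, so every point of `ℙ¹(ℂ)` mapped
to `c ≠ 0` by an iterate lies in `ℂˣ` (`rankTwoRecurrenceSet_monomial`). On `ℂˣ` the two iterates are
`z ↦ z ^ (d₁ ^ m)` and `z ↦ ζ ^ s * z ^ (d₂ ^ n)` with `s = 1 + d₂ + ⋯ + d₂ ^ (n-1)`.

Let `A` and `B` be the quotients of `d₁ ^ m` and `d₂ ^ n` by their greatest common divisor. As `ℂˣ`
is divisible, `z ^ (d₁ ^ m) = c` and `z ^ (d₂ ^ n) = ζ ^ (-s) * c` have a common solution if and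
only if `c ^ B = (ζ ^ (-s) * c) ^ A` (`exists_zpow_eq_and_zpow_eq_iff`). Since `ζ` and `c` are
`N`-th roots of unity for some `N > 0`, this depends only on `A`, `B` and `s` modulo `N`.

It remains to see that these residues have semilinear fibres as functions of `(m, n)`. Up to sign,
`A` is a product of powers `p ^ (α m - β n)`, with truncated subtraction, over primes `p`. The
sequence `k ↦ p ^ k` modulo `N` is an orbit in a finite set, hence ultimately periodic, so its fibres
are semilinear in `ℕ`; pulling them back along the Presburger-definable map `(m, n) ↦ α m - β n`
keeps them semilinear (`SemilinearMeasurable.comp_mul_tsub_mul`). The exponent `s` modulo `N` is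
likewise an orbit in a finite set, and semilinear sets are closed under the finite intersections
and unions needed to combine these functions.
-/

/-! ### Monomial maps on the Riemann sphere -/

section Sphere

variable {a : ℂ}

theorem num_denom_C_mul_X_pow (a : ℂ) (n : ℕ) :
    (RatFunc.C a * RatFunc.X ^ n).num = Polynomial.C a * Polynomial.X ^ n ∧
      (RatFunc.C a * RatFunc.X ^ n).denom = 1 := by
  have h : (RatFunc.C a * RatFunc.X ^ n) =
      algebraMap ℂ[X] (RatFunc ℂ) (Polynomial.C a * Polynomial.X ^ n) := by simp
  rw [h]
  exact ⟨RatFunc.num_algebraMap _, RatFunc.denom_algebraMap _⟩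

theorem num_denom_C_div_X_pow (ha : a ≠ 0) (n : ℕ) :
    (RatFunc.C a / RatFunc.X ^ n).num = Polynomial.C a ∧
      (RatFunc.C a / RatFunc.X ^ n).denom = Polynomial.X ^ n := by
  have h : (RatFunc.C a / RatFunc.X ^ n) =
      algebraMap ℂ[X] (RatFunc ℂ) (Polynomial.C a) /
        algebraMap ℂ[X] (RatFunc ℂ) (Polynomial.X ^ n) := by simp
  have hg : gcd (Polynomial.C a) (Polynomial.X ^ n : ℂ[X]) = 1 := by
    rw [← normalize_gcd]
    exact normalize_eq_one.2 (isUnit_of_dvd_unit (gcd_dvd_left _ _)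
      (Polynomial.isUnit_C.2 (isUnit_iff_ne_zero.2 ha)))
  rw [h, RatFunc.num_div, RatFunc.denom_div _ (pow_ne_zero n Polynomial.X_ne_zero), hg]
  simp

theorem ratMap_monomial_coe (ha : a ≠ 0) (d : ℤ) {z : ℂ} (hz : z ≠ 0) :
    ratMap (RatFunc.C a * RatFunc.X ^ d) (z : OnePoint ℂ) = ((a * z ^ d : ℂ) : OnePoint ℂ) := by
  obtain ⟨n, rfl | rfl⟩ := d.eq_nat_or_neg
  · obtain ⟨h₁, h₂⟩ := num_denom_C_mul_X_pow a n
    change (if _ then _ else _) = _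
    simp [h₁, h₂]
  · obtain ⟨h₁, h₂⟩ := num_denom_C_div_X_pow ha n
    rw [zpow_neg, zpow_natCast, ← div_eq_mul_inv]
    change (if _ then _ else _) = _
    simp only [h₁, h₂]
    simp [hz, div_eq_mul_inv]

/-- A nonconstant monomial map preserves `{0, ∞}`, so neither point lies in the backward orbit of
a nonzero number. -/
theorem mapsTo_ratMap_monomial (ha : a ≠ 0) {d : ℤ} (hd : d ≠ 0) :
    Set.MapsTo (ratMap (RatFunc.C a * RatFunc.X ^ d))
      {((0 : ℂ) : OnePoint ℂ), ∞} {((0 : ℂ) : OnePoint ℂ), ∞} := by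
  obtain ⟨n, rfl | rfl⟩ := d.eq_nat_or_neg
  · have hn : n ≠ 0 := by simpa using hd
    obtain ⟨h₁, h₂⟩ := num_denom_C_mul_X_pow a n
    rintro _ (rfl | rfl)
    · left
      change (if _ then _ else _) = _
      simp [h₁, h₂, hn]
    · right
      change (if _ then _ else _) = _
      simp [h₁, h₂, ha, Nat.pos_of_ne_zero hn]
  · have hn : n ≠ 0 := by simpa using hd
    obtain ⟨h₁, h₂⟩ := num_denom_C_div_X_pow ha n
    rw [zpow_neg, zpow_natCast, ← div_eq_mul_inv]
    rintro _ (rfl | rfl)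
    · right
      change (if _ then _ else _) = _
      simp [h₂, hn]
    · left
      change (if _ then _ else _) = _
      simp [h₁, h₂, Polynomial.coeff_C, hn]

theorem ratMap_C (c : ℂ) (z : OnePoint ℂ) : ratMap (RatFunc.C c) z = (c : OnePoint ℂ) := by
  cases z using OnePoint.rec with
  | infty =>
    change (if _ then _ else _) = _
    simp
  | coe z =>
    change (if _ then _ else _) = _
    simp

/-- The exponent of `ζ` in the `n`-th iterate of `w ↦ ζ * w ^ d`, that is, `1 + d + ⋯ + d ^ (n-1)`,
written as an orbit of `x ↦ 1 + d * x` in a ring `R` so that it can also be read modulo `N`. -/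
def iterExponent {R : Type*} [Ring R] (d : R) (n : ℕ) : R :=
  (fun x => 1 + d * x)^[n] 0

theorem iterExponent_succ {R : Type*} [Ring R] (d : R) (n : ℕ) :
    iterExponent d (n + 1) = 1 + d * iterExponent d n :=
  Function.iterate_succ_apply' _ _ _

theorem iterate_monomial (ha : a ≠ 0) (d : ℤ) (n : ℕ) (z : ℂ) :
    (fun w : ℂ => a * w ^ d)^[n] z = a ^ iterExponent d n * z ^ d ^ n := by
  induction n with
  | zero => simp [iterExponent]
  | succ n ih =>
    rw [Function.iterate_succ_apply', ih, iterExponent_succ, zpow_add₀ ha, mul_zpow, ← zpow_mul,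
      ← zpow_mul, pow_succ, zpow_one, mul_comm d, mul_assoc]

theorem iterate_ratMap_monomial_coe (ha : a ≠ 0) (d : ℤ) (n : ℕ) {z : ℂ} (hz : z ≠ 0) :
    (ratMap (RatFunc.C a * RatFunc.X ^ d))^[n] (z : OnePoint ℂ) =
      (((fun w : ℂ => a * w ^ d)^[n] z : ℂ) : OnePoint ℂ) := by
  induction n with
  | zero => rfl
  | succ n ih =>
    rw [Function.iterate_succ_apply', ih, Function.iterate_succ_apply', ratMap_monomial_coe ha]
    rw [iterate_monomial ha d n z]
    exact mul_ne_zero (zpow_ne_zero _ ha) (zpow_ne_zero _ hz)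

theorem rankTwoRecurrenceSet_monomial {a b c : ℂ} (ha : a ≠ 0) (hb : b ≠ 0) (hc : c ≠ 0)
    (d₁ : ℤ) {d₂ : ℤ} (hd₂ : d₂ ≠ 0) :
    rankTwoRecurrenceSet (RatFunc.C a * RatFunc.X ^ d₁) (RatFunc.C b * RatFunc.X ^ d₂)
        (RatFunc.C c) =
      {p : ℕ × ℕ | ∃ z : ℂˣ,
        (fun w : ℂ => a * w ^ d₁)^[p.1] (z : ℂ) = (fun w : ℂ => b * w ^ d₂)^[p.2] (z : ℂ) ∧
        (fun w : ℂ => b * w ^ d₂)^[p.2] (z : ℂ) = c} := by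
  ext p
  constructor
  · rintro ⟨z, h₁, h₂⟩
    rw [ratMap_C] at h₂
    have hz : z ∉ ({((0 : ℂ) : OnePoint ℂ), ∞} : Set (OnePoint ℂ)) := by
      intro hz
      have := (mapsTo_ratMap_monomial hb hd₂).iterate p.2 hz
      rw [h₂] at this
      simp [hc] at this
    cases z using OnePoint.rec with
    | infty => simp at hz
    | coe z =>
      have hz0 : z ≠ 0 := by
        rintro rfl
        simp at hz
      rw [iterate_ratMap_monomial_coe hb d₂ _ hz0] at h₁ h₂
      rw [iterate_ratMap_monomial_coe ha d₁ _ hz0] at h₁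
      exact ⟨Units.mk0 z hz0, OnePoint.coe_injective h₁, OnePoint.coe_injective h₂⟩
  · rintro ⟨z, h₁, h₂⟩
    refine ⟨((z : ℂ) : OnePoint ℂ), ?_, ?_⟩
    · rw [iterate_ratMap_monomial_coe hb d₂ _ z.ne_zero,
        iterate_ratMap_monomial_coe ha d₁ _ z.ne_zero, h₁]
    · rw [iterate_ratMap_monomial_coe hb d₂ _ z.ne_zero, ratMap_C, h₂]

end Sphere

/-! ### Simultaneous power equations in a divisible group -/

/-- If every element of `G` has a `g`-th root, then `z ↦ (z ^ (g A), z ^ (g B))` with `A`, `B`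
coprime has image `{(c, e) | c ^ B = e ^ A}`: a Bézout relation `u A + v B = 1` shows that any
`g`-th root of `c ^ u * e ^ v` is a preimage. -/
theorem exists_zpow_eq_and_zpow_eq_iff {G : Type*} [CommGroup G] {g A B : ℤ}
    (hroot : ∀ x : G, ∃ z, z ^ g = x) (hAB : IsCoprime A B) (c e : G) :
    (∃ z : G, z ^ (g * A) = c ∧ z ^ (g * B) = e) ↔ c ^ B = e ^ A := by
  constructor
  · rintro ⟨z, rfl, rfl⟩
    rw [← zpow_mul, ← zpow_mul]
    congr 1
    ring
  · intro h
    obtain ⟨u, v, huv⟩ := hAB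
    obtain ⟨z, hz⟩ := hroot (c ^ u * e ^ v)
    refine ⟨z, ?_, ?_⟩
    · calc z ^ (g * A) = c ^ (u * A) * (e ^ A) ^ v := by
            rw [zpow_mul, hz, mul_zpow, ← zpow_mul, ← zpow_mul, ← zpow_mul, mul_comm v]
        _ = c ^ (u * A + v * B) := by rw [← h, ← zpow_mul, ← zpow_add, mul_comm v]
        _ = c := by rw [huv, zpow_one]
    · calc z ^ (g * B) = (c ^ B) ^ u * e ^ (v * B) := by
            rw [zpow_mul, hz, mul_zpow, ← zpow_mul, ← zpow_mul, ← zpow_mul, mul_comm u]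
        _ = e ^ (u * A + v * B) := by rw [h, ← zpow_mul, ← zpow_add, mul_comm u]
        _ = e := by rw [huv, zpow_one]

theorem Complex.exists_units_zpow_eq {g : ℤ} (hg : g ≠ 0) (x : ℂˣ) : ∃ z : ℂˣ, z ^ g = x := by
  have key : ∀ n : ℕ, n ≠ 0 → ∀ y : ℂˣ, ∃ z : ℂˣ, z ^ n = y := by
    intro n hn y
    obtain ⟨z, hz⟩ := IsAlgClosed.exists_pow_nat_eq (y : ℂ) (Nat.pos_of_ne_zero hn)
    have hz0 : z ≠ 0 := by
      rintro rfl
      rw [zero_pow hn] at hz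
      exact y.ne_zero hz.symm
    exact ⟨Units.mk0 z hz0, Units.ext (by simpa using hz)⟩
  obtain ⟨n, rfl | rfl⟩ := g.eq_nat_or_neg
  · obtain ⟨z, hz⟩ := key n (by simpa using hg) x
    exact ⟨z, by rw [zpow_natCast, hz]⟩
  · obtain ⟨z, hz⟩ := key n (by simpa using hg) x⁻¹
    exact ⟨z, by rw [zpow_neg, zpow_natCast, hz, inv_inv]⟩

/-! ### The quotient of a power by a greatest common divisor -/

/-- For `a, b ≠ 0` and a set of primes `P` containing those that divide `a`, this is
`a ^ m / gcd (a ^ m) (b ^ n)`: the exponent of `p` is the truncated difference of the `p`-adic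
valuations of `a ^ m` and `b ^ n`. -/
def powDivGcd (P : Finset ℕ) (a b : ℤ) (m n : ℕ) : ℤ :=
  a.sign ^ m * ∏ p ∈ P, (p : ℤ) ^
    (a.natAbs.factorization p * m - b.natAbs.factorization p * n)

/-- The common divisor of `a ^ m` and `b ^ n` complementary to `powDivGcd`. -/
def powGcd (P : Finset ℕ) (a b : ℤ) (m n : ℕ) : ℤ :=
  ∏ p ∈ P, (p : ℤ) ^ min (a.natAbs.factorization p * m) (b.natAbs.factorization p * n)

theorem powGcd_comm (P : Finset ℕ) (a b : ℤ) (m n : ℕ) :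
    powGcd P a b m n = powGcd P b a n m :=
  Finset.prod_congr rfl fun _ _ => by rw [min_comm]

theorem powGcd_ne_zero {P : Finset ℕ} (hP : ∀ p ∈ P, p.Prime) (a b : ℤ) (m n : ℕ) :
    powGcd P a b m n ≠ 0 :=
  Finset.prod_ne_zero_iff.2 fun p hp => pow_ne_zero _ (by exact_mod_cast (hP p hp).ne_zero)

theorem powGcd_mul_powDivGcd {P : Finset ℕ} {a : ℤ} (ha : a ≠ 0)
    (hP : a.natAbs.primeFactors ⊆ P) (b : ℤ) (m n : ℕ) :
    powGcd P a b m n * powDivGcd P a b m n = a ^ m := by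
  have h : (a.natAbs : ℤ) ^ m = ∏ p ∈ P, (p : ℤ) ^ (a.natAbs.factorization p * m) := by
    conv_lhs => rw [← Nat.prod_factorization_pow_eq_self (Int.natAbs_ne_zero.2 ha)]
    rw [Finsupp.prod_of_support_subset _ hP _ (by simp)]
    push_cast
    rw [← Finset.prod_pow]
    exact Finset.prod_congr rfl fun p _ => (pow_mul _ _ _).symm
  rw [powGcd, powDivGcd, mul_left_comm, ← Finset.prod_mul_distrib]
  conv_rhs => rw [← Int.sign_mul_natAbs a, mul_pow, h]
  congr 1
  refine Finset.prod_congr rfl fun p _ => ?_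
  rw [← pow_add]
  congr 1
  omega

theorem isCoprime_powDivGcd {P : Finset ℕ} (hP : ∀ p ∈ P, p.Prime) {a b : ℤ} (ha : a ≠ 0)
    (hb : b ≠ 0) (m n : ℕ) : IsCoprime (powDivGcd P a b m n) (powDivGcd P b a n m) := by
  have hs : ∀ {x : ℤ}, x ≠ 0 → ∀ k : ℕ, IsUnit (x.sign ^ k) := fun hx k =>
    (Int.isUnit_iff_natAbs_eq.2 (Int.natAbs_sign_of_ne_zero hx)).pow k
  rw [powDivGcd, powDivGcd, isCoprime_mul_unit_left_left (hs ha m),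
    isCoprime_mul_unit_left_right (hs hb n)]
  refine IsCoprime.prod_left fun p hp => IsCoprime.prod_right fun q hq => ?_
  rcases eq_or_ne p q with rfl | hpq
  · -- the two truncated differences cannot both be positive
    rcases le_total (a.natAbs.factorization p * m) (b.natAbs.factorization p * n) with h | h
    · rw [Nat.sub_eq_zero_of_le h, pow_zero]
      exact isCoprime_one_left
    · rw [Nat.sub_eq_zero_of_le h, pow_zero]
      exact isCoprime_one_right
  · exact (Nat.isCoprime_iff_coprime.2 ((Nat.coprime_primes (hP p hp) (hP q hq)).2 hpq)).pow

/-! ### Functions with semilinear fibres -/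

/-- A function on a commutative monoid is semilinear-measurable if all preimages of sets are
semilinear; for a function with finite range this only concerns the fibres. -/
def SemilinearMeasurable {M α : Type*} [AddCommMonoid M] (φ : M → α) : Prop :=
  ∀ t : Set α, IsSemilinearSet (φ ⁻¹' t)

namespace SemilinearMeasurable

variable {M N α β γ : Type*} [AddCommMonoid M] [AddCommMonoid N]

theorem of_fiber [Finite α] {φ : M → α} (h : ∀ x, IsSemilinearSet (φ ⁻¹' {x})) :
    SemilinearMeasurable φ := fun t => by
  rw [← Set.biUnion_preimage_singleton]
  exact IsSemilinearSet.biUnion t.toFinite fun x _ => h x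

theorem prodMk [Finite α] [Finite β] {φ : M → α} {ψ : M → β} (hφ : SemilinearMeasurable φ)
    (hψ : SemilinearMeasurable ψ) : SemilinearMeasurable fun p => (φ p, ψ p) := by
  refine of_fiber fun x => ?_
  convert (hφ {x.1}).inter (hψ {x.2}) using 1
  ext p
  simp [Prod.ext_iff]

theorem map₂ [Finite α] [Finite β] {φ : M → α} {ψ : M → β} (hφ : SemilinearMeasurable φ)
    (hψ : SemilinearMeasurable ψ) (f : α → β → γ) :
    SemilinearMeasurable fun p => f (φ p) (ψ p) :=
  fun t => hφ.prodMk hψ (Function.uncurry f ⁻¹' t)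

theorem comp_hom [AddMonoid.FG M] {φ : N → α} (hφ : SemilinearMeasurable φ) (f : M →+ N) :
    SemilinearMeasurable fun p => φ (f p) :=
  fun t => (hφ t).preimage f

theorem const [AddMonoid.FG M] (x : α) : SemilinearMeasurable fun _ : M => x := fun t => by
  by_cases h : x ∈ t
  · simp [h, IsSemilinearSet.univ]
  · simp [h, IsSemilinearSet.empty]

theorem finsetProd [AddMonoid.FG M] [Finite α] [CommMonoid α] {ι : Type*} (s : Finset ι)
    {φ : ι → M → α} (h : ∀ i ∈ s, SemilinearMeasurable (φ i)) :
    SemilinearMeasurable fun p => ∏ i ∈ s, φ i p := by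
  classical
  induction s using Finset.induction_on with
  | empty => simpa using const 1
  | insert i s hi ih =>
    simp only [Finset.prod_insert hi]
    exact (h i (s.mem_insert_self i)).map₂
      (ih fun j hj => h j (Finset.mem_insert_of_mem hj)) (· * ·)

/-- Orbits of self-maps of finite sets are ultimately periodic. -/
theorem iterate [Finite α] (T : α → α) (x : α) :
    SemilinearMeasurable fun k : ℕ => T^[k] x := fun t => by
  rw [Nat.isSemilinearSet_iff_ultimately_periodic]
  obtain ⟨i, j, hij, h⟩ : ∃ i j : ℕ, i < j ∧ T^[i] x = T^[j] x := by
    obtain ⟨i, j, hne, h⟩ := Finite.exists_ne_map_eq_of_infinite fun k : ℕ => T^[k] x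
    rcases lt_or_gt_of_ne hne with hlt | hlt
    · exact ⟨i, j, hlt, h⟩
    · exact ⟨j, i, hlt, h.symm⟩
  refine ⟨i, j - i, Nat.sub_pos_of_lt hij, fun k hk => ?_⟩
  have hT : T^[k] x = T^[k + (j - i)] x := by
    obtain ⟨r, rfl⟩ := Nat.exists_eq_add_of_le' hk
    rw [show r + i + (j - i) = r + j by omega, Function.iterate_add_apply, h,
      ← Function.iterate_add_apply]
  simp only [Set.mem_preimage, hT]

theorem pow [Finite α] [Monoid α] (x : α) : SemilinearMeasurable fun k : ℕ => x ^ k := by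
  simpa using iterate (x * ·) 1

/-- The graph of `(m, n) ↦ a m - b n` (truncated) is semilinear, hence precomposition with this
map preserves semilinear measurability. -/
theorem comp_mul_tsub_mul {φ : ℕ → α} (hφ : SemilinearMeasurable φ) (a b : ℕ) :
    SemilinearMeasurable fun p : ℕ × ℕ => φ (a * p.1 - b * p.2) := fun t => by
  let m : (ℕ × ℕ) × ℕ →+ ℕ := (AddMonoidHom.fst ℕ ℕ).comp (AddMonoidHom.fst _ _)
  let n : (ℕ × ℕ) × ℕ →+ ℕ := (AddMonoidHom.snd ℕ ℕ).comp (AddMonoidHom.fst _ _)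
  let k : (ℕ × ℕ) × ℕ →+ ℕ := AddMonoidHom.snd _ _
  -- Either `a m = b n + k`, and the truncated difference is `k`, or `a m + k = b n`, and it is `0`.
  have h₁ : IsSemilinearSet {q | 0 + (a • m) q = 0 + (b • n + k) q} :=
    isSemilinearSet_setOfPred_eq _ _ _ _
  have h₂ : IsSemilinearSet {q | 0 + (a • m + k) q = 0 + (b • n) q} :=
    isSemilinearSet_setOfPred_eq _ _ _ _
  have h₃ : IsSemilinearSet {q : (ℕ × ℕ) × ℕ | φ 0 ∈ t} := const (φ 0) t
  convert ((h₁.inter ((hφ.comp_hom k) t)).union (h₂.inter h₃)).image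
    (AddMonoidHom.fst (ℕ × ℕ) ℕ) using 1
  ext p
  constructor
  · intro h
    rcases le_total (b * p.2) (a * p.1) with hle | hle
    · refine ⟨(p, a * p.1 - b * p.2), Or.inl ⟨?_, h⟩, rfl⟩
      change 0 + a * p.1 = 0 + (b * p.2 + (a * p.1 - b * p.2))
      omega
    · refine ⟨(p, b * p.2 - a * p.1), Or.inr ⟨?_, ?_⟩, rfl⟩
      · change 0 + (a * p.1 + (b * p.2 - a * p.1)) = 0 + b * p.2
        omega
      · rwa [Set.mem_preimage, Nat.sub_eq_zero_of_le hle] at h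
  · rintro ⟨⟨p, r⟩, ⟨h, hr⟩ | ⟨h, hr⟩, rfl⟩
    · change 0 + a * p.1 = 0 + (b * p.2 + r) at h
      change φ (a * p.1 - b * p.2) ∈ t
      rwa [show a * p.1 - b * p.2 = r by omega]
    · change 0 + (a * p.1 + r) = 0 + b * p.2 at h
      change φ (a * p.1 - b * p.2) ∈ t
      rwa [show a * p.1 - b * p.2 = 0 by omega]

end SemilinearMeasurable

theorem semilinearMeasurable_powDivGcd (N : ℕ) [NeZero N] (P : Finset ℕ) (a b : ℤ) :
    SemilinearMeasurable fun p : ℕ × ℕ => (powDivGcd P a b p.1 p.2 : ZMod N) := by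
  simp only [powDivGcd, Int.cast_mul, Int.cast_pow, Int.cast_prod]
  exact ((SemilinearMeasurable.pow _).comp_hom (AddMonoidHom.fst ℕ ℕ)).map₂
    (SemilinearMeasurable.finsetProd P fun p _ =>
      (SemilinearMeasurable.pow _).comp_mul_tsub_mul _ _) (· * ·)

theorem intCast_iterExponent {R : Type*} [Ring R] (d : ℤ) (n : ℕ) :
    ((iterExponent d n : ℤ) : R) = iterExponent (d : R) n := by
  induction n with
  | zero => simp [iterExponent]
  | succ n ih => simp [iterExponent_succ, ih]

theorem semilinearMeasurable_iterExponent (N : ℕ) [NeZero N] (d : ℤ) :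
    SemilinearMeasurable fun p : ℕ × ℕ => iterExponent (d : ZMod N) p.2 :=
  (SemilinearMeasurable.iterate _ _).comp_hom (AddMonoidHom.snd ℕ ℕ)

/-! ### Semilinearity of the recurrence set -/

theorem zpow_eq_pow_val_of_pow_eq_one {G : Type*} [Group G] {x : G} {N : ℕ} [NeZero N]
    (hx : x ^ N = 1) (k : ℤ) : x ^ k = x ^ (k : ZMod N).val := by
  rw [← zpow_natCast, ZMod.val_intCast, zpow_eq_zpow_emod' k hx]

/-- The criterion for a common solution of `z ^ (d₁ ^ m) = c` and `ζ ^ s * z ^ (d₂ ^ n) = c`,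
with `s = 1 + d₂ + ⋯ + d₂ ^ (n-1)`. -/
theorem exists_iterate_eq_iff {d₁ d₂ : ℤ} (hd₁ : d₁ ≠ 0) (hd₂ : d₂ ≠ 0) {P : Finset ℕ}
    (hP : ∀ p ∈ P, p.Prime) (h₁ : d₁.natAbs.primeFactors ⊆ P) (h₂ : d₂.natAbs.primeFactors ⊆ P)
    (ζ c : ℂˣ) (m n : ℕ) :
    (∃ z : ℂˣ, z ^ d₁ ^ m = c ∧ ζ ^ iterExponent d₂ n * z ^ d₂ ^ n = c) ↔
      c ^ powDivGcd P d₂ d₁ n m =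
        ((ζ ^ iterExponent d₂ n)⁻¹ * c) ^ powDivGcd P d₁ d₂ m n := by
  rw [← exists_zpow_eq_and_zpow_eq_iff (Complex.exists_units_zpow_eq (powGcd_ne_zero hP d₁ d₂ m n))
    (isCoprime_powDivGcd hP hd₁ hd₂ m n), powGcd_mul_powDivGcd hd₁ h₁, powGcd_comm,
    powGcd_mul_powDivGcd hd₂ h₂]
  simp only [eq_inv_mul_iff_mul_eq]

theorem isSemilinearSet_exists_iterate_eq {d₁ d₂ : ℤ} (hd₁ : d₁ ≠ 0) (hd₂ : d₂ ≠ 0) (ζ c : ℂˣ)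
    {N : ℕ} [NeZero N] (hζ : ζ ^ N = 1) (hc : c ^ N = 1) :
    IsSemilinearSet {p : ℕ × ℕ | ∃ z : ℂˣ,
      z ^ d₁ ^ p.1 = c ∧ ζ ^ iterExponent d₂ p.2 * z ^ d₂ ^ p.2 = c} := by
  let P := d₁.natAbs.primeFactors ∪ d₂.natAbs.primeFactors
  have hP : ∀ p ∈ P, p.Prime := fun p hp => (Finset.mem_union.1 hp).elim
    Nat.prime_of_mem_primeFactors Nat.prime_of_mem_primeFactors
  have hA := semilinearMeasurable_powDivGcd N P d₁ d₂
  have hB : SemilinearMeasurable fun p : ℕ × ℕ => (powDivGcd P d₂ d₁ p.2 p.1 : ZMod N) :=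
    (semilinearMeasurable_powDivGcd N P d₂ d₁).comp_hom
      (AddEquiv.prodComm : ℕ × ℕ ≃+ ℕ × ℕ).toAddMonoidHom
  have hs := semilinearMeasurable_iterExponent N d₂
  convert ((hA.prodMk hB).prodMk hs) {x | c ^ x.1.2.val = ((ζ ^ x.2.val)⁻¹ * c) ^ x.1.1.val}
    using 1
  ext ⟨m, n⟩
  have hζc : ∀ k : ℕ, ((ζ ^ k)⁻¹ * c) ^ N = 1 := fun k => by
    rw [mul_pow, hc, inv_pow, pow_right_comm, hζ, one_pow, inv_one, mul_one]
  simp only [Set.mem_ofPred_eq, Set.mem_preimage]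
  rw [exists_iterate_eq_iff hd₁ hd₂ hP Finset.subset_union_left Finset.subset_union_right,
    zpow_eq_pow_val_of_pow_eq_one hζ, zpow_eq_pow_val_of_pow_eq_one hc,
    zpow_eq_pow_val_of_pow_eq_one (hζc _), intCast_iterExponent]

theorem mainTheorem7 (d₁ d₂ : ℤ) (hd₁ : 2 ≤ |d₁|) (hd₂ : 2 ≤ |d₂|)
    (ζ c : ℂ) (hζ : ∃ k : ℕ, 0 < k ∧ ζ ^ k = 1) (hc : ∃ k : ℕ, 0 < k ∧ c ^ k = 1) :
    rankTwoRecurrenceSet (RatFunc.X ^ d₁) (RatFunc.C ζ * RatFunc.X ^ d₂) (RatFunc.C c) =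
        {p : ℕ × ℕ | ∃ z : ℂˣ,
          (fun w : ℂ => w ^ d₁)^[p.1] (z : ℂ) = (fun w : ℂ => ζ * w ^ d₂)^[p.2] (z : ℂ) ∧
          (fun w : ℂ => ζ * w ^ d₂)^[p.2] (z : ℂ) = c} ∧
      IsSemilinearSet
        (rankTwoRecurrenceSet (RatFunc.X ^ d₁) (RatFunc.C ζ * RatFunc.X ^ d₂) (RatFunc.C c)) := by
  obtain ⟨k, hk, hζk⟩ := hζ
  obtain ⟨l, hl, hcl⟩ := hc
  have hζ0 : ζ ≠ 0 := by
    rintro rfl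
    simp [hk.ne'] at hζk
  have hc0 : c ≠ 0 := by
    rintro rfl
    simp [hl.ne'] at hcl
  have hd₁0 : d₁ ≠ 0 := by
    rintro rfl
    simp at hd₁
  have hd₂0 : d₂ ≠ 0 := by
    rintro rfl
    simp at hd₂
  have key := rankTwoRecurrenceSet_monomial one_ne_zero hζ0 hc0 d₁ hd₂0
  rw [map_one, one_mul] at key
  refine ⟨by simpa only [one_mul] using key, ?_⟩
  rw [key]
  have : NeZero (k * l) := ⟨(Nat.mul_pos hk hl).ne'⟩
  convert isSemilinearSet_exists_iterate_eq (N := k * l) hd₁0 hd₂0 (Units.mk0 ζ hζ0)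
    (Units.mk0 c hc0) (Units.ext (by simp [pow_mul, hζk]))
    (Units.ext (by simp [mul_comm k, pow_mul, hcl])) using 1
  ext p
  simp only [Set.mem_ofPred_eq]
  refine exists_congr fun z => ?_
  rw [iterate_monomial one_ne_zero d₁, iterate_monomial hζ0 d₂, one_zpow,
    one_mul, Units.ext_iff, Units.ext_iff]
  push_cast
  simp only [Units.val_mk0]
  exact ⟨fun ⟨h, h'⟩ => ⟨h.trans h', h'⟩, fun ⟨h, h'⟩ => ⟨h.trans h'.symm, h'⟩⟩
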